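/- Let $G$ be an abelian group. For a locally compact Hausdorff space $X$, call $E\subseteq X$ bounded if $\overline{E}$ is compact. For $n\ge 0$ let $K_n(X,G)$ be the group, under pointwise addition, of the functions $f$ that assign to each $(n+1)$-tuple $(E_0,\dots,E_n)$ of bounded subsets of $X$ an element of $G$, such that 1. if $E_i=E_i'\cup E_i''$ and $E_i'\cap E_i''=\varnothing$, then $f(\dots,E_i,\dots)=f(\dots,E_i',\dots)+f(\dots,E_i'',\dots)$; 2. $f(E_{\sigma(0)},\dots,E_{\sigma(n)})=\operatorname{sgn}(\sigma)\,f(E_0,\dots,E_n)$ for every permutation $\sigma$, and $f(E_0,\dots,E_n)=0$ if $E_i=E_j$ for some $i\ne j$; 3. $f(E_0,\dots,E_n)=0$ if $\overline{E_0}\cap\dots\cap\overline{E_n}=\varnothing$. For $n\ge 1$ the boundary $\Delta:K_n(X,G)\to K_{n-1}(X,G)$ is $\Delta f(E_0,\dots,E_{n-1})=f(U,E_0,\dots,E_{n-1})$, where $U$ is any bounded open set containing $\bigcup_{i=0}^{n-1}\overline{E_i}$ (the value does not depend on $U$), and $\Delta=0$ on $K_0(X,G)$. The Kolmogoroff homology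 $H^K_*(X;G)$ is the homology of $(K_*(X,G),\Delta)$. For a closed subspace $A\subseteq X$, with inclusion $i:A\to X$, let $i_*:K_*(A,G)\to K_*(X,G)$ be the chain map $(i_*f)(E_0,\dots,E_n)=f(E_0\cap A,\dots,E_n\cap A)$; the relative homology $H^K_*(X,A;G)$ is the homology of the quotient complex $K_*(X,G)/i_*K_*(A,G)$. **Corollary 2.** Let $X$ be a locally compact, paracompact Hausdorff space, let $\dot X=X\cup\{*\}$ be its one-point Alexandroff compactification, and let $G$ be an abelian group. Then the inclusion $\rho:X\to(\dot X,*)$ induces for every $n\ge 0$ an isomorphism $$\rho_*: H^K_n(X;G)\overset{\sim}{\longrightarrow} H^K_n(\dot X,*;G).$$ Here $\rho_*$ is the inverse of the homomorphism $H^K_n(\dot X,*;G)\to H^K_n(X;G)$ that is induced by the restriction of chains along the open inclusion $\rho$: a chain $f\in K_n(\dot X,G)$ is sent to the chain $(E_0,\dots,E_n)\mapsto f(E_0,\dots,E_n)$ on bounded subsets $E_i$ of $X$, and chains coming from $*$ are sent to $0$. In particular, this restriction homomorphism is an isomorphism. -/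

import Mathlib

open CategoryTheory CategoryTheory.Limits Topology

universe u v

namespace Kolmogoroff

section Chains

variable {X Y : Type u} [TopologicalSpace X] [TopologicalSpace Y] {G : Type v} [AddCommGroup G]

/-- The bounded subsets of `X`: those with compact closure. -/
abbrev Bdd (X : Type u) [TopologicalSpace X] : Type u := {E : Set X // IsCompact (closure E)}

/-- The defining conditions of an `n`-dimensional Kolmogoroff chain. -/
structure IsChain {n : ℕ} (f : (Fin (n + 1) → Bdd X) → G) : Prop where
  /-- additivity in each argument -/
  add : ∀ (E : Fin (n + 1) → Bdd X) (i : Fin (n + 1)) (A B : Bdd X),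
    (E i).1 = A.1 ∪ B.1 → A.1 ∩ B.1 = ∅ →
      f E = f (Function.update E i A) + f (Function.update E i B)
  /-- skew-symmetry -/
  perm : ∀ (E : Fin (n + 1) → Bdd X) (σ : Equiv.Perm (Fin (n + 1))),
    f (fun i => E (σ i)) = (Equiv.Perm.sign σ : ℤ) • f E
  /-- vanishing when two arguments coincide -/
  alt : ∀ (E : Fin (n + 1) → Bdd X) (i j : Fin (n + 1)), i ≠ j → E i = E j → f E = 0
  /-- vanishing when the closures have no common point -/
  supp : ∀ E : Fin (n + 1) → Bdd X, ⋂ i, closure (E i).1 = ∅ → f E = 0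

/-- The group `K_n(X, G)` of `n`-dimensional Kolmogoroff chains, under pointwise addition. -/
def chains (X : Type u) [TopologicalSpace X] (G : Type v) [AddCommGroup G] (n : ℕ) :
    AddSubgroup ((Fin (n + 1) → Bdd X) → G) where
  carrier := {f | IsChain f}
  zero_mem' := by constructor <;> simp
  add_mem' := by
    intro f g hf hg
    refine ⟨fun E i A B h h' => ?_, fun E σ => ?_, fun E i j h h' => ?_, fun E h => ?_⟩
    · simp only [Pi.add_apply, hf.add E i A B h h', hg.add E i A B h h']; abel
    · simp only [Pi.add_apply, hf.perm E σ, hg.perm E σ, smul_add]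
    · simp only [Pi.add_apply, hf.alt E i j h h', hg.alt E i j h h', add_zero]
    · simp only [Pi.add_apply, hf.supp E h, hg.supp E h, add_zero]
  neg_mem' := by
    intro f hf
    refine ⟨fun E i A B h h' => ?_, fun E σ => ?_, fun E i j h h' => ?_, fun E h => ?_⟩
    · simp only [Pi.neg_apply, hf.add E i A B h h']; abel
    · simp only [Pi.neg_apply, hf.perm E σ, smul_neg]
    · simp only [Pi.neg_apply, hf.alt E i j h h', neg_zero]
    · simp only [Pi.neg_apply, hf.supp E h, neg_zero]

/-- `U` may be used to compute the boundary at `E`: it is open and contains all `closure (E i)`. -/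
def Surrounds {n : ℕ} (U : Bdd X) (E : Fin (n + 1) → Bdd X) : Prop :=
  IsOpen U.1 ∧ ⋃ i, closure (E i).1 ⊆ U.1

theorem Surrounds.closure_subset {n : ℕ} {U : Bdd X} {E : Fin (n + 1) → Bdd X}
    (h : Surrounds U E) (i : Fin (n + 1)) : closure (E i).1 ⊆ U.1 :=
  (Set.subset_iUnion (fun i => closure (E i).1) i).trans h.2

theorem exists_surrounds [LocallyCompactSpace X] [T2Space X] {n : ℕ} (E : Fin (n + 1) → Bdd X) :
    ∃ U : Bdd X, Surrounds U E := by
  obtain ⟨U, hU, hEU, hc⟩ := exists_isOpen_superset_and_isCompact_closure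
    (isCompact_iUnion fun i => (E i).2)
  exact ⟨⟨U, hc⟩, hU, hEU⟩

/-- A bounded open set surrounding `E`. -/
noncomputable def surround [LocallyCompactSpace X] [T2Space X] {n : ℕ}
    (E : Fin (n + 1) → Bdd X) : Bdd X :=
  (exists_surrounds E).choose

theorem surround_spec [LocallyCompactSpace X] [T2Space X] {n : ℕ} (E : Fin (n + 1) → Bdd X) :
    Surrounds (surround E) E :=
  (exists_surrounds E).choose_spec

/-- Replacing the first argument by a subset that is still a neighbourhood of the closure of some
other argument does not change the value. -/
theorem IsChain.cons_eq_of_subset {n : ℕ} {f : (Fin (n + 1 + 1) → Bdd X) → G} (hf : IsChain f)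
    (E : Fin (n + 1) → Bdd X) (i : Fin (n + 1)) (U V : Bdd X) (hV : IsOpen V.1)
    (hVU : V.1 ⊆ U.1) (hi : closure (E i).1 ⊆ V.1) :
    f (Fin.cons U E) = f (Fin.cons V E) := by
  have hW : IsCompact (closure (U.1 \ V.1)) :=
    U.2.of_isClosed_subset isClosed_closure (closure_mono Set.sdiff_subset)
  have h := hf.add (Fin.cons U E) 0 V ⟨U.1 \ V.1, hW⟩
    (Set.union_sdiff_cancel hVU).symm (Set.inter_sdiff_self _ _)
  rw [Fin.update_cons_zero, Fin.update_cons_zero] at h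
  rw [h, hf.supp (Fin.cons ⟨U.1 \ V.1, hW⟩ E), add_zero]
  rw [Set.eq_empty_iff_forall_notMem]
  intro x hx
  rw [Set.mem_iInter] at hx
  have h0 : x ∈ closure (U.1 \ V.1) := by simpa using hx 0
  have h1 : x ∈ closure (E i).1 := by simpa using hx i.succ
  have h2 : closure (U.1 \ V.1) ⊆ V.1ᶜ :=
    closure_minimal (fun y hy => hy.2) hV.isClosed_compl
  exact h2 h0 (hi h1)

theorem IsChain.cons_eq {n : ℕ} {f : (Fin (n + 1 + 1) → Bdd X) → G} (hf : IsChain f)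
    (E : Fin (n + 1) → Bdd X) (i : Fin (n + 1)) (U V : Bdd X) (hU : IsOpen U.1) (hV : IsOpen V.1)
    (hiU : closure (E i).1 ⊆ U.1) (hiV : closure (E i).1 ⊆ V.1) :
    f (Fin.cons U E) = f (Fin.cons V E) := by
  have hW : IsCompact (closure (U.1 ∩ V.1)) :=
    U.2.of_isClosed_subset isClosed_closure (closure_mono Set.inter_subset_left)
  rw [hf.cons_eq_of_subset E i U ⟨U.1 ∩ V.1, hW⟩ (hU.inter hV) Set.inter_subset_left
      (Set.subset_inter hiU hiV),
    hf.cons_eq_of_subset E i V ⟨U.1 ∩ V.1, hW⟩ (hU.inter hV) Set.inter_subset_right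
      (Set.subset_inter hiU hiV)]

section Boundary

variable [LocallyCompactSpace X] [T2Space X]

/-- The boundary `Δ f (E₀, …, E_{n-1}) = f (U, E₀, …, E_{n-1})`, as a function. -/
noncomputable def bdryFun {n : ℕ} (f : (Fin (n + 1 + 1) → Bdd X) → G)
    (E : Fin (n + 1) → Bdd X) : G :=
  f (Fin.cons (surround E) E)

/-- The boundary does not depend on the choice of the surrounding set. -/
theorem bdryFun_eq {n : ℕ} {f : (Fin (n + 1 + 1) → Bdd X) → G} (hf : IsChain f)
    (E : Fin (n + 1) → Bdd X) (U : Bdd X) (hU : Surrounds U E) :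
    bdryFun f E = f (Fin.cons U E) :=
  hf.cons_eq E 0 _ U (surround_spec E).1 hU.1 ((surround_spec E).closure_subset 0)
    (hU.closure_subset 0)

theorem IsChain.bdryFun {n : ℕ} {f : (Fin (n + 1 + 1) → Bdd X) → G} (hf : IsChain f) :
    IsChain (bdryFun f) := by
  refine ⟨fun E i A B h h' => ?_, fun E σ => ?_, fun E i j h h' => ?_, fun E h => ?_⟩
  · have key : ∀ C : Bdd X, C.1 ⊆ (E i).1 → Surrounds (surround E) (Function.update E i C) := by
      intro C hC
      refine ⟨(surround_spec E).1, Set.iUnion_subset fun j => ?_⟩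
      by_cases hj : j = i
      · subst hj
        rw [Function.update_self]
        exact (closure_mono hC).trans ((surround_spec E).closure_subset j)
      · rw [Function.update_of_ne hj]
        exact (surround_spec E).closure_subset j
    rw [bdryFun_eq hf _ _ (surround_spec E),
      bdryFun_eq hf _ _ (key A (h ▸ Set.subset_union_left)),
      bdryFun_eq hf _ _ (key B (h ▸ Set.subset_union_right)), Fin.cons_update, Fin.cons_update]
    exact hf.add _ i.succ A B (by simpa using h) h'
  · have hs : Surrounds (surround E) (fun i => E (σ i)) :=
      ⟨(surround_spec E).1, Set.iUnion_subset fun j => (surround_spec E).closure_subset (σ j)⟩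
    rw [bdryFun_eq hf _ _ hs, bdryFun_eq hf _ _ (surround_spec E)]
    have h := hf.perm (Fin.cons (surround E) E) (Equiv.Perm.decomposeFin.symm (0, σ))
    rw [Equiv.Perm.decomposeFin.symm_sign, if_pos rfl, one_mul] at h
    rw [← h]
    congr 1
    funext j
    refine Fin.cases ?_ (fun k => ?_) j
    · simp
    · simp
  · exact hf.alt _ i.succ j.succ (by simpa using h) (by simpa using h')
  · refine hf.supp _ ?_
    rw [Set.eq_empty_iff_forall_notMem] at h ⊢
    intro x hx
    rw [Set.mem_iInter] at hx
    exact h x (Set.mem_iInter.2 fun i => by simpa using hx i.succ)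

theorem IsChain.bdryFun_bdryFun {n : ℕ} {f : (Fin (n + 1 + 1 + 1) → Bdd X) → G}
    (hf : IsChain f) (E : Fin (n + 1) → Bdd X) :
    Kolmogoroff.bdryFun (Kolmogoroff.bdryFun f) E = 0 := by
  set U := surround E with hU
  set W := surround (Fin.cons U E : Fin (n + 1 + 1) → Bdd X) with hW
  have hWs := surround_spec (Fin.cons U E : Fin (n + 1 + 1) → Bdd X)
  change f (Fin.cons W (Fin.cons U E)) = 0
  have h1 := hf.perm (Fin.cons W (Fin.cons U E)) (Equiv.swap 0 1)
  have h2 : (fun i => (Fin.cons W (Fin.cons U E) : Fin (n + 1 + 1 + 1) → Bdd X)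
      (Equiv.swap 0 1 i)) = Fin.cons U (Fin.cons W E) := by
    funext j
    refine Fin.cases ?_ (fun k => Fin.cases ?_ (fun l => ?_) k) j
    · rw [Equiv.swap_apply_left]; rfl
    · rw [Fin.succ_zero_eq_one, Equiv.swap_apply_right]; rfl
    · rw [Equiv.swap_apply_of_ne_of_ne (Fin.succ_ne_zero _)
        (by
          rw [← Fin.succ_zero_eq_one]
          exact fun h => Fin.succ_ne_zero l (Fin.succ_injective _ h))]
      rfl
  have h3 : f (Fin.cons U (Fin.cons W E)) = f (Fin.cons W (Fin.cons W E)) := by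
    refine hf.cons_eq (Fin.cons W E) (Fin.succ 0) U W (surround_spec E).1 hWs.1 ?_ ?_
    · exact (surround_spec E).closure_subset 0
    · exact hWs.closure_subset (Fin.succ 0)
  rw [h2, h3, hf.alt (Fin.cons W (Fin.cons W E)) 0 (Fin.succ 0) (Fin.succ_ne_zero 0).symm rfl,
    Equiv.Perm.sign_swap (by simp)] at h1
  simpa using h1

/-- The boundary operator `Δ : K_{n+1}(X, G) → K_n(X, G)`. -/
noncomputable def bdry (X : Type u) [TopologicalSpace X] [LocallyCompactSpace X] [T2Space X]
    (G : Type v) [AddCommGroup G] (n : ℕ) : chains X G (n + 1) →+ chains X G n where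
  toFun f := ⟨bdryFun f.1, IsChain.bdryFun f.2⟩
  map_zero' := rfl
  map_add' _ _ := rfl

end Boundary

/-- Precomposition with an operation on bounded sets that preserves disjoint unions and families
of sets whose closures have no common point. -/
theorem IsChain.comp {n : ℕ} {f : (Fin (n + 1) → Bdd X) → G} (hf : IsChain f)
    (φ : Bdd Y → Bdd X)
    (hu : ∀ A B C : Bdd Y, C.1 = A.1 ∪ B.1 → (φ C).1 = (φ A).1 ∪ (φ B).1)
    (hd : ∀ A B : Bdd Y, A.1 ∩ B.1 = ∅ → (φ A).1 ∩ (φ B).1 = ∅)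
    (hs : ∀ E : Fin (n + 1) → Bdd Y, ⋂ i, closure (E i).1 = ∅ → ⋂ i, closure (φ (E i)).1 = ∅) :
    IsChain (fun E : Fin (n + 1) → Bdd Y => f (fun i => φ (E i))) := by
  have key : ∀ (E : Fin (n + 1) → Bdd Y) (i : Fin (n + 1)) (A : Bdd Y),
      (fun j => φ (Function.update E i A j)) = Function.update (fun j => φ (E j)) i (φ A) := by
    intro E i A
    funext j
    by_cases hj : j = i
    · subst hj; simp
    · simp [hj]
  refine ⟨fun E i A B h h' => ?_, fun E σ => ?_, fun E i j h h' => ?_, fun E h => ?_⟩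
  · simp only [key]
    exact hf.add _ i _ _ (hu A B (E i) h) (hd A B h')
  · exact hf.perm (fun i => φ (E i)) σ
  · exact hf.alt _ i j h (congrArg φ h')
  · exact hf.supp _ (hs E h)

/-- The preimage of a bounded set under a proper map. -/
def Bdd.preimage (p : X → Y) (hp : IsProperMap p) (E : Bdd Y) : Bdd X :=
  ⟨p ⁻¹' E.1, (hp.isCompact_preimage E.2).of_isClosed_subset isClosed_closure
    (hp.continuous.closure_preimage_subset E.1)⟩

/-- The image of a bounded set under a continuous map to a Hausdorff space. -/
def Bdd.image [T2Space Y] (j : X → Y) (hj : Continuous j) (E : Bdd X) : Bdd Y :=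
  ⟨j '' E.1, (E.2.image hj).of_isClosed_subset isClosed_closure
    (closure_minimal (Set.image_mono subset_closure) (E.2.image hj).isClosed)⟩

theorem Bdd.closure_image [T2Space Y] (j : X → Y) (hj : Continuous j) (E : Bdd X) :
    closure (Bdd.image j hj E).1 = j '' closure E.1 :=
  (closure_minimal (Set.image_mono subset_closure) (E.2.image hj).isClosed).antisymm
    (image_closure_subset_closure_image hj)

/-- A proper map `p : X → Y` induces `p_* : K_n(X, G) → K_n(Y, G)`,
`(p_* f)(E₀, …, E_n) = f (p⁻¹ E₀, …, p⁻¹ E_n)`. -/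
def push (G : Type v) [AddCommGroup G] (p : X → Y) (hp : IsProperMap p) (n : ℕ) :
    chains X G n →+ chains Y G n where
  toFun f := ⟨fun E => f.1 (fun i => Bdd.preimage p hp (E i)), by
    refine IsChain.comp f.2 (Bdd.preimage p hp) (fun A B C h => ?_) (fun A B h => ?_)
      (fun E h => ?_)
    · simp only [Bdd.preimage, h, Set.preimage_union]
    · simp only [Bdd.preimage, ← Set.preimage_inter, h, Set.preimage_empty]
    · rw [Set.eq_empty_iff_forall_notMem] at h ⊢
      intro x hx
      rw [Set.mem_iInter] at hx
      exact h (p x) (Set.mem_iInter.2 fun i =>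
        hp.continuous.closure_preimage_subset (E i).1 (hx i))⟩
  map_zero' := rfl
  map_add' _ _ := rfl

/-- An open embedding `j : X → Y` induces the restriction `K_n(Y, G) → K_n(X, G)`,
`f ↦ ((E₀, …, E_n) ↦ f (j E₀, …, j E_n))`. -/
def restrict [T2Space Y] (G : Type v) [AddCommGroup G] (j : X → Y) (hj : IsOpenEmbedding j)
    (n : ℕ) : chains Y G n →+ chains X G n where
  toFun f := ⟨fun E => f.1 (fun i => Bdd.image j hj.continuous (E i)), by
    refine IsChain.comp f.2 (Bdd.image j hj.continuous) (fun A B C h => ?_) (fun A B h => ?_)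
      (fun E h => ?_)
    · simp only [Bdd.image, h, Set.image_union]
    · simp only [Bdd.image, ← Set.image_inter hj.injective, h, Set.image_empty]
    · simp only [Bdd.closure_image]
      rw [← Set.InjOn.image_iInter_eq hj.injective.injOn, h, Set.image_empty]⟩
  map_zero' := rfl
  map_add' _ _ := rfl

theorem push_bdry [LocallyCompactSpace X] [T2Space X] [LocallyCompactSpace Y] [T2Space Y]
    (p : X → Y) (hp : IsProperMap p) (n : ℕ) (f : chains X G (n + 1)) :
    bdry Y G n (push G p hp (n + 1) f) = push G p hp n (bdry X G n f) := by
  refine Subtype.ext (funext fun E => ?_)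
  have hs : Surrounds (Bdd.preimage p hp (surround E)) (fun i => Bdd.preimage p hp (E i)) :=
    ⟨(surround_spec E).1.preimage hp.continuous, Set.iUnion_subset fun i =>
      (hp.continuous.closure_preimage_subset (E i).1).trans
        (Set.preimage_mono ((surround_spec E).closure_subset i))⟩
  refine Eq.trans ?_ (bdryFun_eq f.2 _ _ hs).symm
  change f.1 _ = f.1 _
  refine congrArg f.1 (funext fun i => ?_)
  refine Fin.cases ?_ (fun k => ?_) i <;> rfl

theorem restrict_bdry [LocallyCompactSpace X] [T2Space X] [LocallyCompactSpace Y] [T2Space Y]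
    (j : X → Y) (hj : IsOpenEmbedding j) (n : ℕ) (f : chains Y G (n + 1)) :
    bdry X G n (restrict G j hj (n + 1) f) = restrict G j hj n (bdry Y G n f) := by
  refine Subtype.ext (funext fun E => ?_)
  have hs : Surrounds (Bdd.image j hj.continuous (surround E))
      (fun i => Bdd.image j hj.continuous (E i)) :=
    ⟨hj.isOpenMap _ (surround_spec E).1, Set.iUnion_subset fun i => by
      rw [Bdd.closure_image]
      exact Set.image_mono ((surround_spec E).closure_subset i)⟩
  refine Eq.trans ?_ (bdryFun_eq f.2 _ _ hs).symm
  change f.1 _ = f.1 _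
  refine congrArg f.1 (funext fun i => ?_)
  refine Fin.cases ?_ (fun k => ?_) i <;> rfl

/-- Restricting to an open set that misses the image of `p` annihilates `p_*`. -/
theorem restrict_push {A : Type u} [TopologicalSpace A] [T2Space Y] (p : A → Y)
    (hp : IsProperMap p) (j : X → Y) (hj : IsOpenEmbedding j) (h : ∀ a x, p a ≠ j x) (n : ℕ)
    (f : chains A G n) : restrict G j hj n (push G p hp n f) = 0 := by
  refine Subtype.ext (funext fun E => ?_)
  refine IsChain.supp f.2 _ ?_
  have he : ∀ i, (Bdd.preimage p hp (Bdd.image j hj.continuous (E i))).1 = ∅ := by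
    intro i
    rw [Set.eq_empty_iff_forall_notMem]
    rintro a ⟨x, -, hx⟩
    exact h a x hx.symm
  simp only [he, closure_empty]
  exact Set.iInter_const _

end Chains

section Complex

variable (X : Type u) [TopologicalSpace X] [LocallyCompactSpace X] [T2Space X]
  {Y : Type u} [TopologicalSpace Y] [LocallyCompactSpace Y] [T2Space Y]
  (G : Type v) [AddCommGroup G]

/-- The Kolmogoroff chain complex `K_*(X, G)`. -/
noncomputable def complex : ChainComplex AddCommGrpCat.{max u v} ℕ :=
  ChainComplex.of (fun n => AddCommGrpCat.of (chains X G n))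
    (fun n => AddCommGrpCat.ofHom (bdry X G n)) (fun n => by
      refine AddCommGrpCat.hom_ext (AddMonoidHom.ext fun f => ?_)
      exact Subtype.ext (funext fun E => IsChain.bdryFun_bdryFun f.2 E))

/-- Kolmogoroff homology of a locally compact Hausdorff space. -/
noncomputable def homology (n : ℕ) : AddCommGrpCat.{max u v} :=
  (complex X G).homology n

variable {X}

/-- The chain map `K_*(X, G) → K_*(Y, G)` induced by a proper map. -/
noncomputable def pushMap (p : X → Y) (hp : IsProperMap p) : complex X G ⟶ complex Y G :=
  ChainComplex.ofHom (fun n => AddCommGrpCat.ofHom (push G p hp n)) (fun n => by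
    simp only [complex, ChainComplex.of_d]
    refine AddCommGrpCat.hom_ext (AddMonoidHom.ext fun f => ?_)
    exact push_bdry p hp n f)

/-- The chain map `K_*(Y, G) → K_*(X, G)` induced by an open embedding `X → Y`. -/
noncomputable def restrictMap (j : X → Y) (hj : IsOpenEmbedding j) :
    complex Y G ⟶ complex X G :=
  ChainComplex.ofHom (fun n => AddCommGrpCat.ofHom (restrict G j hj n)) (fun n => by
    simp only [complex, ChainComplex.of_d]
    refine AddCommGrpCat.hom_ext (AddMonoidHom.ext fun f => ?_)
    exact restrict_bdry j hj n f)

theorem isProperMap_val {Z : Type u} [TopologicalSpace Z] {A : Set Z} (hA : IsClosed A) :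
    IsProperMap ((↑) : A → Z) :=
  hA.isClosedEmbedding_subtypeVal.isProperMap

/-- The relative chain complex `K_*(Y, A; G) = K_*(Y, G) / K_*(A, G)` of a closed subspace `A`:
the cokernel of the chain map induced by the inclusion `A → Y`. -/
noncomputable def relComplex (A : Set Y) (hA : IsClosed A) :
    ChainComplex AddCommGrpCat.{max u v} ℕ :=
  haveI : LocallyCompactSpace A := hA.isClosedEmbedding_subtypeVal.locallyCompactSpace
  cokernel (pushMap G ((↑) : A → Y) (isProperMap_val hA))

/-- Relative Kolmogoroff homology of a closed pair. -/
noncomputable def relHomology (A : Set Y) (hA : IsClosed A) (n : ℕ) :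
    AddCommGrpCat.{max u v} :=
  (relComplex G A hA).homology n

/-- The chain map `K_*(Y, A; G) → K_*(X, G)` induced by an open embedding `j : X → Y` whose image
misses the closed set `A`. -/
noncomputable def relRestrictMap (A : Set Y) (hA : IsClosed A) (j : X → Y)
    (hj : IsOpenEmbedding j) (h : ∀ x, j x ∉ A) : relComplex G A hA ⟶ complex X G :=
  haveI : LocallyCompactSpace A := hA.isClosedEmbedding_subtypeVal.locallyCompactSpace
  cokernel.desc (pushMap G ((↑) : A → Y) (isProperMap_val hA)) (restrictMap G j hj) (by
    refine HomologicalComplex.hom_ext _ _ fun n => ?_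
    refine AddCommGrpCat.hom_ext (AddMonoidHom.ext fun f => ?_)
    exact restrict_push _ (isProperMap_val hA) j hj (fun a x e => h x (e ▸ a.2)) n f)

/-- The map `H_n(Y, A; G) → H_n(X; G)` induced on homology by an open embedding `j : X → Y` whose
image misses `A`. Kolmogoroff chains are covariant for proper maps and contravariant for open
embeddings; `X → (Y, A)` acts on homology through this map. -/
noncomputable def relRestrict (A : Set Y) (hA : IsClosed A) (j : X → Y)
    (hj : IsOpenEmbedding j) (h : ∀ x, j x ∉ A) (n : ℕ) :
    relHomology G A hA n ⟶ homology X G n :=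
  HomologicalComplex.homologyMap (relRestrictMap G A hA j hj h) n

end Complex

end Kolmogoroff

/-! The group of chains on `Y` with values in `G` is `Hom(S(Y), G)`, where `S(Y)` is spanned by the
alternating indicator functions of boxes of bounded sets, evaluated at tuples of ultrafilters with
a common limit: relations between boxes can be checked on a common partition into disjoint pieces.

For an open embedding `j : X → Y`, `S(X)` is the kernel of the restriction of `S(Y)` to the tuples
converging to points outside `range j`. The restricted functions take finitely many integer values,
so by Nöbeling's theorem they lie in a free group, `Ext¹` of the image vanishes, and every chain on
`X` extends to `Y`: restriction of chains is surjective.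

When `range j = {y}ᶜ`, the chains restricting to zero are those supported at `y`. Prepending the
principal ultrafilter at `y` turns a box determinant into a larger one, and Laplace expansion along
the new row defines a cone operator on these chains which contracts the kernel of the restriction,
up to chains pushed forward from `{y}` in degree `0`. -/

namespace Kolmogoroff

section LinearAlgebra

theorem exists_injective_linearMap_divisibleBy (G : Type v) [AddCommGroup G] :
    ∃ (D : Type v) (_ : AddCommGroup D) (_ : DivisibleBy D ℤ) (e : G →ₗ[ℤ] D),
      Function.Injective e := by
  refine ⟨CharacterModule G → AddCircle (1 : ℚ), inferInstance, inferInstance,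
    LinearMap.pi fun χ => χ.toIntLinearMap, (injective_iff_map_eq_zero _).2 fun g hg => ?_⟩
  exact CharacterModule.eq_zero_of_character_apply fun χ => congrFun hg χ

/-- The obstruction to extending `f` is a class in `Ext¹(range r, G)`, and `range r` is projective
because `ℤ` is hereditary: a quotient `D ⧸ G` of an injective group `D` is injective. -/
theorem exists_comp_subtype_ker_eq {S F : Type*} {G : Type v} [AddCommGroup S] [AddCommGroup F]
    [AddCommGroup G] [Module.Projective ℤ F] (r : S →ₗ[ℤ] F) (f : r.ker →ₗ[ℤ] G) :
    ∃ g : S →ₗ[ℤ] G, g ∘ₗ r.ker.subtype = f := by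
  obtain ⟨D, _, _, e, he⟩ := exists_injective_linearMap_divisibleBy G
  have : DivisibleBy (D ⧸ e.range) ℤ :=
    (Submodule.mkQ_surjective e.range).divisibleBy _ fun d k => map_zsmul e.range.mkQ k d
  obtain ⟨g, hg⟩ := (Module.Baer.of_divisible D).extension_property r.ker.subtype
    r.ker.injective_subtype (e ∘ₗ f)
  have hker : r.ker ≤ (e.range.mkQ ∘ₗ g).ker := fun x hx => by
    have hgx : g x = e (f ⟨x, hx⟩) := LinearMap.congr_fun hg ⟨x, hx⟩
    simp [hgx]
  obtain ⟨h, hh⟩ := (Module.Baer.of_divisible (D ⧸ e.range)).extension_property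
    (r.ker.liftQ r le_rfl) (LinearMap.ker_eq_bot.1 (r.ker.ker_liftQ_eq_bot _ _ le_rfl))
    (r.ker.liftQ _ hker)
  obtain ⟨h', rfl⟩ := Module.projective_lifting_property e.range.mkQ h e.range.mkQ_surjective
  have hmem : ∀ x, (g - h' ∘ₗ r) x ∈ e.range := fun x => by
    rw [← Submodule.Quotient.mk_eq_zero, LinearMap.sub_apply, Submodule.Quotient.mk_sub,
      sub_eq_zero]
    exact (LinearMap.congr_fun hh (r.ker.mkQ x)).symm
  refine ⟨(LinearEquiv.ofInjective e he).symm ∘ₗ (g - h' ∘ₗ r).codRestrict e.range hmem,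
    LinearMap.ext fun x => ?_⟩
  rw [LinearMap.comp_apply, LinearMap.comp_apply, LinearEquiv.coe_coe, LinearEquiv.symm_apply_eq]
  refine Subtype.ext ?_
  have hgx : g x = e (f x) := LinearMap.congr_fun hg x
  have hrx : r x = 0 := x.2
  simp [hgx, hrx]

theorem exists_span_range_linearMap {R ι M N : Type*} [Ring R] [AddCommGroup M] [AddCommGroup N]
    [Module R M] [Module R N] {v : ι → M} {w : ι → N}
    (h : (Finsupp.linearCombination R v).ker ≤ (Finsupp.linearCombination R w).ker) :
    ∃ φ : Submodule.span R (Set.range v) →ₗ[R] N,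
      ∀ i, φ ⟨v i, Submodule.subset_span ⟨i, rfl⟩⟩ = w i := by
  let e := (Finsupp.linearCombination R v).quotKerEquivRange.trans
    (LinearEquiv.ofEq _ _ (Finsupp.range_linearCombination R))
  refine ⟨Submodule.liftQ _ _ h ∘ₗ e.symm.toLinearMap, fun i => ?_⟩
  have hi : e.symm ⟨v i, Submodule.subset_span ⟨i, rfl⟩⟩ =
      Submodule.Quotient.mk (Finsupp.single i 1) := by
    rw [LinearEquiv.symm_apply_eq]
    exact Subtype.ext (by simp [e])
  simp [hi]

/-- The group of functions `ι → ℤ` with finitely many values, the target of the restriction maps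
along which chains are extended. -/
def finiteRange (ι : Type*) : Submodule ℤ (ι → ℤ) where
  carrier := {f | (Set.range f).Finite}
  zero_mem' := (Set.finite_singleton 0).subset (Set.range_subset_iff.2 fun _ => rfl)
  add_mem' {f g} hf hg := (hf.image2 (· + ·) hg).subset
    (Set.range_subset_iff.2 fun i => ⟨f i, ⟨i, rfl⟩, g i, ⟨i, rfl⟩, rfl⟩)
  smul_mem' k f hf := (hf.image (k • ·)).subset
    (Set.range_subset_iff.2 fun i => ⟨f i, ⟨i, rfl⟩, rfl⟩)

/-- Nöbeling's theorem applies because functions on `ι` with finitely many values are the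
locally constant functions on its Stone–Čech compactification. -/
instance free_finiteRange (ι : Type*) : Module.Free ℤ (finiteRange ι) := by
  have hfin : ∀ φ : LocallyConstant (Ultrafilter ι) ℤ,
      φ ∘ pure ∈ finiteRange ι := fun φ =>
    φ.range_finite.subset (Set.range_comp_subset_range _ _)
  let ev : LocallyConstant (Ultrafilter ι) ℤ →ₗ[ℤ] finiteRange ι :=
    ((LinearMap.funLeft ℤ ℤ pure) ∘ₗ LocallyConstant.coeFnₗ ℤ).codRestrict _ hfin
  have hinj : Function.Injective ev := fun φ ψ h => LocallyConstant.coe_injective <|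
    denseRange_pure.equalizer φ.continuous ψ.continuous (congrArg Subtype.val h)
  have hsurj : Function.Surjective ev := by
    rintro ⟨f, hf⟩
    have : Finite (Set.range f) := hf
    let F : Ultrafilter ι → Set.range f := Ultrafilter.extend (Set.rangeFactorization f)
    have hF : Continuous F := continuous_ultrafilter_extend _
    refine ⟨⟨fun u => F u, ?_⟩, Subtype.ext (funext fun i => ?_)⟩
    · exact (IsLocallyConstant.iff_continuous _).2 (continuous_subtype_val.comp hF)
    · exact congrArg Subtype.val
        (congrFun (ultrafilter_extend_extends (Set.rangeFactorization f)) i)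
  have : Module.Free ℤ (LocallyConstant (Ultrafilter ι) ℤ) :=
    LocallyConstant.freeOfProfinite (Profinite.of (Ultrafilter ι))
  exact Module.Free.of_equiv (LinearEquiv.ofBijective ev ⟨hinj, hsurj⟩)

/-- A Cauchy–Binet expansion: the sum of an alternating `b` over all tuples, weighted by products
of matrix entries, collected over the increasing tuples. -/
theorem sum_prod_smul_eq_sum_det_smul {N : ℕ} {ι H : Type*} [Fintype ι] [LinearOrder ι]
    [AddCommGroup H] (M : Matrix ι (Fin N) ℤ) (b : (Fin N → ι) → H)
    (hperm : ∀ (j : Fin N → ι) (σ : Equiv.Perm (Fin N)), b (j ∘ σ) = (σ.sign : ℤ) • b j)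
    (hinj : ∀ j : Fin N → ι, ¬ Function.Injective j → b j = 0) :
    ∑ j, (∏ i, M (j i) i) • b j =
      ∑ s : {s : Fin N → ι // StrictMono s}, (M.submatrix s id).det • b s := by
  have hdet : ∀ s : {s : Fin N → ι // StrictMono s}, (M.submatrix s id).det • b s =
      ∑ σ : Equiv.Perm (Fin N), (∏ i, M (s.1 (σ i)) i) • b (s ∘ σ) := fun s => by
    simp only [Matrix.det_apply', Matrix.submatrix_apply, id, Finset.sum_smul, hperm, smul_smul,
      mul_comm, Int.cast_id]
  rw [Fintype.sum_congr _ _ hdet, ← Fintype.sum_prod_type']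
  refine (Finset.sum_of_injOn
    (fun x : {s : Fin N → ι // StrictMono s} × Equiv.Perm (Fin N) => x.1.1 ∘ x.2)
    ?_ (by simp) ?_ fun _ _ => rfl).symm
  · rintro ⟨⟨s, hs⟩, σ⟩ - ⟨⟨t, ht⟩, τ⟩ - (h : s ∘ σ = t ∘ τ)
    have hrange : Set.range s = Set.range t := by
      rw [← σ.surjective.range_comp s, h, τ.surjective.range_comp t]
    obtain rfl : s = t := (StrictMono.range_inj hs ht).1 hrange
    obtain rfl : σ = τ := Equiv.ext fun i => hs.injective (congrFun h i)
    rfl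
  · intro j _ hj
    rw [hinj j, smul_zero]
    intro hi
    have hsort : StrictMono (j ∘ Tuple.sort j) :=
      (Tuple.monotone_sort j).strictMono_of_injective (hi.comp (Tuple.sort j).injective)
    exact hj ⟨⟨⟨_, hsort⟩, (Tuple.sort j)⁻¹⟩, by simp, funext fun i => by simp⟩

end LinearAlgebra

section Additive

variable {Y : Type u} [TopologicalSpace Y] {H : Type*} [AddCommGroup H]

theorem Bdd.isCompact_closure_of_subset {A : Bdd Y} {s : Set Y} (h : s ⊆ A.1) :
    IsCompact (closure s) :=
  A.2.of_isClosed_subset isClosed_closure (closure_mono h)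

/-- Additivity in each argument of a function of tuples of bounded sets, as required of chains. -/
def IsAdditive {N : ℕ} (b : (Fin N → Bdd Y) → H) : Prop :=
  ∀ (E : Fin N → Bdd Y) (i : Fin N) (A B : Bdd Y),
    (E i).1 = A.1 ∪ B.1 → A.1 ∩ B.1 = ∅ →
      b E = b (Function.update E i A) + b (Function.update E i B)

theorem IsAdditive.eq_zero_of_eq_empty {N : ℕ} {b : (Fin N → Bdd Y) → H} (hb : IsAdditive b)
    {E : Fin N → Bdd Y} {i : Fin N} (h : (E i).1 = ∅) : b E = 0 := by
  have hadd := hb E i (E i) (E i) (Set.union_self _).symm (by rw [h, Set.inter_self])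
  rwa [Function.update_eq_self, left_eq_add] at hadd

theorem IsAdditive.eq_sum_update {N : ℕ} {ι : Type*} {b : (Fin N → Bdd Y) → H}
    (hb : IsAdditive b) {p : ι → Bdd Y} (hp : Pairwise (Function.onFun Disjoint fun a => (p a).1))
    (i : Fin N) (S : Finset ι) (E : Fin N → Bdd Y) (hE : (E i).1 = ⋃ a ∈ S, (p a).1) :
    b E = ∑ a ∈ S, b (Function.update E i (p a)) := by
  classical
  induction S using Finset.induction_on generalizing E with
  | empty => simpa using hb.eq_zero_of_eq_empty (by simpa using hE)
  | insert a S ha ih =>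
    let U : Bdd Y := ⟨⋃ a ∈ S, (p a).1, Bdd.isCompact_closure_of_subset (A := E i)
      (hE ▸ Set.biUnion_subset_biUnion_left (by simp))⟩
    have hdisj : (p a).1 ∩ U.1 = ∅ := Set.disjoint_iff_inter_eq_empty.1 <|
      Set.disjoint_iUnion₂_right.2 fun c hc => hp (ne_of_mem_of_not_mem hc ha).symm
    rw [Finset.sum_insert ha, hb E i (p a) U (by rw [hE]; simp [U]) hdisj,
      ih (Function.update E i U) (by simp [U])]
    simp

theorem IsAdditive.eq_sum_prod_smul {N : ℕ} {ι : Type*} [Fintype ι] [DecidableEq ι]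
    {b : (Fin N → Bdd Y) → H} (hb : IsAdditive b) {p : ι → Bdd Y}
    (hp : Pairwise (Function.onFun Disjoint fun a => (p a).1)) {S : Fin N → Finset ι}
    {E : Fin N → Bdd Y} (hE : ∀ i, (E i).1 = ⋃ a ∈ S i, (p a).1) :
    b E = ∑ j : Fin N → ι, (∏ i, if j i ∈ S i then (1 : ℤ) else 0) • b (p ∘ j) := by
  induction N with
  | zero => simpa using congrArg b (Subsingleton.elim _ _)
  | succ N ih =>
    have htail : ∀ a, b (Function.update E 0 (p a)) = ∑ k : Fin N → ι,
        (∏ i, if k i ∈ S i.succ then (1 : ℤ) else 0) • b (p ∘ Fin.cons a k) := fun a => by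
      have hcons : IsAdditive fun F : Fin N → Bdd Y => b (Fin.cons (p a) F) := by
        intro F i A B h h'
        simp only [Fin.cons_update]
        exact hb _ i.succ A B h h'
      rw [← Fin.cons_self_tail E, Fin.update_cons_zero,
        ih hcons (E := Fin.tail E) fun i => hE i.succ]
      simp only [Fin.comp_cons]
    rw [hb.eq_sum_update hp 0 (S 0) E (hE 0), ← (Fin.consEquiv fun _ => ι).sum_comp,
      Fintype.sum_prod_type]
    simp [Fin.consEquiv, htail, Fin.prod_univ_succ, Finset.sum_ite_mem]

theorem exists_common_partition (F : Finset (Bdd Y)) :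
    ∃ (ι : Type u) (_ : Fintype ι) (_ : LinearOrder ι) (p : ι → Bdd Y) (S : Bdd Y → Finset ι),
      Pairwise (Function.onFun Disjoint fun a => (p a).1) ∧
        ∀ A ∈ F, A.1 = ⋃ a ∈ S A, (p a).1 := by
  classical
  let atom (J : Finset F) : Set Y := {y | J.Nonempty ∧ ∀ A : F, A ∈ J ↔ y ∈ A.1.1}
  have hatom : ∀ J, IsCompact (closure (atom J)) := fun J => by
    obtain rfl | ⟨A, hA⟩ := J.eq_empty_or_nonempty
    · simp [atom]
    · exact Bdd.isCompact_closure_of_subset (A := A.1) fun y hy => (hy.2 A).1 hA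
  refine ⟨Finset F, inferInstance, linearOrderOfSTO WellOrderingRel, fun J => ⟨atom J, hatom J⟩,
    fun A => {J | ∃ h : A ∈ F, ⟨A, h⟩ ∈ J}, fun J K hJK => ?_, fun A hA => Set.ext fun y => ?_⟩
  · refine Set.disjoint_left.2 fun y hyJ hyK => hJK (Finset.ext fun A => ?_)
    rw [hyJ.2, hyK.2]
  · simp only [Finset.mem_filter_univ, Set.mem_iUnion, exists_prop]
    refine ⟨fun hy => ⟨({B | y ∈ B.1.1} : Finset F), ⟨hA, ?_⟩, ⟨⟨A, hA⟩, ?_⟩, fun B => ?_⟩, ?_⟩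
    · simpa using hy
    · simpa using hy
    · simp
    · rintro ⟨J, ⟨_, hAJ⟩, hy⟩
      exact (hy.2 _).1 hAJ

theorem IsChain.eq_sum_det_smul {n : ℕ} {ι : Type*} [Fintype ι] [LinearOrder ι]
    {f : (Fin (n + 1) → Bdd Y) → H} (hf : IsChain f) {p : ι → Bdd Y}
    (hp : Pairwise (Function.onFun Disjoint fun a => (p a).1)) {S : Fin (n + 1) → Finset ι}
    {E : Fin (n + 1) → Bdd Y} (hE : ∀ i, (E i).1 = ⋃ a ∈ S i, (p a).1) :
    f E = ∑ s : {s : Fin (n + 1) → ι // StrictMono s},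
      (Matrix.of fun l i => if s.1 l ∈ S i then (1 : ℤ) else 0).det • f (p ∘ s) := by
  rw [IsAdditive.eq_sum_prod_smul hf.add hp hE]
  refine sum_prod_smul_eq_sum_det_smul (Matrix.of fun a i => if a ∈ S i then (1 : ℤ) else 0)
    (fun j => f (p ∘ j)) (fun j σ => hf.perm (p ∘ j) σ) fun j hj => ?_
  obtain ⟨i, k, hik, hne⟩ := Function.not_injective_iff.1 hj
  exact hf.alt _ i k hne (congrArg p hik)

end Additive

section Supports

variable {Y : Type u} [TopologicalSpace Y] {H : Type*} [AddCommGroup H]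

/-- A function of tuples of bounded sets is supported on `A` if it vanishes on the tuples whose
closures have no common point in `A`; chains are supported on the whole space. -/
def IsSupportedOn {N : ℕ} (f : (Fin N → Bdd Y) → H) (A : Set Y) : Prop :=
  ∀ E : Fin N → Bdd Y, A ∩ ⋂ i, closure (E i).1 = ∅ → f E = 0

theorem IsChain.isSupportedOn_univ {n : ℕ} {f : (Fin (n + 1) → Bdd Y) → H} (hf : IsChain f) :
    IsSupportedOn f Set.univ :=
  fun E hE => hf.supp E (by rwa [Set.univ_inter] at hE)

/-- The intersection of a bounded set with an arbitrary set, used to localize chains. -/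
def Bdd.inter (E : Bdd Y) (V : Set Y) : Bdd Y :=
  ⟨E.1 ∩ V, Bdd.isCompact_closure_of_subset (A := E) Set.inter_subset_left⟩

theorem IsSupportedOn.eq_update_inter {n : ℕ} {f : (Fin (n + 1) → Bdd Y) → H} {A V : Set Y}
    (hfA : IsSupportedOn f A) (hf : IsChain f) (hV : IsOpen V) (E : Fin (n + 1) → Bdd Y)
    (hE : A ∩ ⋂ i, closure (E i).1 ⊆ V) (i : Fin (n + 1)) :
    f E = f (Function.update E i ((E i).inter V)) := by
  let D : Bdd Y := ⟨(E i).1 \ V, Bdd.isCompact_closure_of_subset (A := E i) Set.sdiff_subset⟩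
  have hD : closure D.1 ⊆ Vᶜ := closure_minimal (fun y hy => hy.2) hV.isClosed_compl
  rw [hf.add E i ((E i).inter V) D (Set.inter_union_sdiff _ _).symm
    (Set.disjoint_iff_inter_eq_empty.1
      (Set.disjoint_left.2 fun y (hy : y ∈ (E i).1 ∩ V) hyD => hyD.2 hy.2)),
    hfA (Function.update E i D), add_zero]
  refine Set.eq_empty_of_forall_notMem fun y ⟨hyA, hy⟩ => ?_
  rw [Set.mem_iInter] at hy
  have hyD : y ∈ closure D.1 := by simpa using hy i
  refine hD hyD (hE ⟨hyA, Set.mem_iInter.2 fun k => ?_⟩)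
  obtain rfl | hk := eq_or_ne k i
  · exact closure_mono Set.sdiff_subset hyD
  · simpa [hk] using hy k

theorem IsSupportedOn.eq_inter {n : ℕ} {f : (Fin (n + 1) → Bdd Y) → H} {A V : Set Y}
    (hfA : IsSupportedOn f A) (hf : IsChain f) (hV : IsOpen V) (E : Fin (n + 1) → Bdd Y)
    (hE : A ∩ ⋂ i, closure (E i).1 ⊆ V) :
    f E = f fun i => (E i).inter V := by
  classical
  have key : ∀ s : Finset (Fin (n + 1)), f E = f (s.piecewise (fun i => (E i).inter V) E) := by
    intro s
    induction s using Finset.induction_on with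
    | empty => simp
    | insert i s hi ih =>
      have hs : ∀ k, (s.piecewise (fun i => (E i).inter V) E k).1 ⊆ (E k).1 := fun k => by
        by_cases hk : k ∈ s
        · exact (Finset.piecewise_eq_of_mem s _ E hk).symm ▸ Set.inter_subset_left
        · rw [Finset.piecewise_eq_of_notMem s _ E hk]
      rw [ih, hfA.eq_update_inter hf hV _ ((Set.inter_subset_inter_right A
        (Set.iInter_mono fun k => closure_mono (hs k))).trans hE) i, Finset.piecewise_insert]
      simp [hi]
  simpa using key Finset.univ

end Supports

section Coefficients

variable {Y : Type u} [TopologicalSpace Y] {H H' : Type*} [AddCommGroup H] [AddCommGroup H']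
  {n : ℕ}

theorem IsChain.map {f : (Fin (n + 1) → Bdd Y) → H} (hf : IsChain f) (φ : H →+ H') :
    IsChain fun E => φ (f E) :=
  ⟨fun E i A B h h' => by rw [hf.add E i A B h h', map_add],
    fun E σ => by rw [hf.perm E σ, map_zsmul],
    fun E i j h h' => by rw [hf.alt E i j h h', map_zero],
    fun E h => by rw [hf.supp E h, map_zero]⟩

theorem IsChain.of_map_injective {f : (Fin (n + 1) → Bdd Y) → H} {φ : H →+ H'}
    (hφ : Function.Injective φ) (hf : IsChain fun E => φ (f E)) : IsChain f :=
  ⟨fun E i A B h h' => hφ (by rw [map_add]; exact hf.add E i A B h h'),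
    fun E σ => hφ (by rw [map_zsmul]; exact hf.perm E σ),
    fun E i j h h' => hφ (by rw [map_zero]; exact hf.alt E i j h h'),
    fun E h => hφ (by rw [map_zero]; exact hf.supp E h)⟩

theorem IsChain.pi {ι : Type*} {f : (Fin (n + 1) → Bdd Y) → ι → H}
    (hf : ∀ t, IsChain fun E => f E t) : IsChain f :=
  ⟨fun E i A B h h' => funext fun t => (hf t).add E i A B h h',
    fun E σ => funext fun t => (hf t).perm E σ,
    fun E i j h h' => funext fun t => (hf t).alt E i j h h',
    fun E h => funext fun t => (hf t).supp E h⟩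

end Coefficients

section BoxDet

variable {Y : Type u} [TopologicalSpace Y] {N n : ℕ}

open Classical in
/-- The alternating indicator function of the box `E₀ × ⋯ × E_{N-1}`, evaluated at a tuple of
ultrafilters: the determinant of the matrix of truth values of `E i ∈ u l`. -/
noncomputable def boxDet (u : Fin N → Ultrafilter Y) (E : Fin N → Bdd Y) : ℤ :=
  (Matrix.of fun l i => if (E i).1 ∈ u l then (1 : ℤ) else 0).det

open Classical in
theorem ite_mem_ultrafilter_eq_add {Z : Type*} (u : Ultrafilter Z) {A B C : Set Z} (h : C = A ∪ B)
    (h' : A ∩ B = ∅) : (if C ∈ u then (1 : ℤ) else 0) =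
      (if A ∈ u then 1 else 0) + if B ∈ u then 1 else 0 := by
  have hAB : ¬ (A ∈ u ∧ B ∈ u) := fun hh =>
    u.empty_notMem (h' ▸ Filter.inter_mem hh.1 hh.2)
  rw [h, Ultrafilter.union_mem_iff]
  by_cases hA : A ∈ u <;> by_cases hB : B ∈ u <;> simp_all

open Classical in
theorem boxDet_update (u : Fin N → Ultrafilter Y) (E : Fin N → Bdd Y) (i : Fin N) (A : Bdd Y) :
    boxDet u (Function.update E i A) =
      ((Matrix.of fun l k => if (E k).1 ∈ u l then (1 : ℤ) else 0).updateCol i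
        fun l => if A.1 ∈ u l then 1 else 0).det := by
  refine congrArg Matrix.det (Matrix.ext fun l k => ?_)
  obtain rfl | hk := eq_or_ne k i
  · simp
  · simp [hk]

theorem isAdditive_boxDet (u : Fin N → Ultrafilter Y) : IsAdditive (boxDet u) := by
  classical
  intro E i A B h h'
  conv_lhs => rw [← Function.update_eq_self i E]
  rw [boxDet_update, boxDet_update, boxDet_update, ← Matrix.det_updateCol_add]
  congr 2
  exact funext fun l => ite_mem_ultrafilter_eq_add (u l) h h'

theorem isSupportedOn_boxDet {u : Fin (n + 1) → Ultrafilter Y} {y : Y}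
    (hu : ∀ l, (u l : Filter Y) ≤ 𝓝 y) : IsSupportedOn (boxDet u) {y} := by
  intro E hE
  obtain ⟨i, hi⟩ : ∃ i, y ∉ closure (E i).1 := by
    simpa [Set.singleton_inter_eq_empty] using hE
  refine Matrix.det_eq_zero_of_column_eq_zero i fun l => if_neg fun hm => ?_
  exact hi (mem_closure_iff_ultrafilter.2 ⟨u l, hm, hu l⟩)

theorem isChain_boxDet {u : Fin (n + 1) → Ultrafilter Y} {y : Y}
    (hu : ∀ l, (u l : Filter Y) ≤ 𝓝 y) : IsChain (boxDet u) where
  add := isAdditive_boxDet u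
  perm E σ := by
    classical
    exact Matrix.det_permute' σ (Matrix.of fun l i => if (E i).1 ∈ u l then (1 : ℤ) else 0)
  alt E i j hij hE := Matrix.det_zero_of_column_eq hij fun l => by
    classical
    exact if_congr (by rw [hE]) rfl rfl
  supp E hE := isSupportedOn_boxDet hu E (by rw [hE, Set.inter_empty])

theorem boxDet_eq_det_of_partition {ι : Type*} [DecidableEq ι] {p : ι → Bdd Y}
    (hp : Pairwise (Function.onFun Disjoint fun a => (p a).1)) {S : Fin N → Finset ι}
    {E : Fin N → Bdd Y} (hE : ∀ i, (E i).1 = ⋃ a ∈ S i, (p a).1)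
    {u : Fin N → Ultrafilter Y} {s : Fin N → ι} (hs : ∀ l, (p (s l)).1 ∈ u l) :
    boxDet u E = (Matrix.of fun l i => if s l ∈ S i then (1 : ℤ) else 0).det := by
  classical
  refine congrArg Matrix.det (Matrix.ext fun l i => if_congr ⟨fun h => ?_, fun h => ?_⟩ rfl rfl)
  · obtain ⟨y, hyE, hys⟩ := (u l).nonempty_of_mem (Filter.inter_mem h (hs l))
    rw [hE] at hyE
    obtain ⟨a, ha, hya⟩ := Set.mem_iUnion₂.1 hyE
    rwa [← hp.eq (Set.not_disjoint_iff.2 ⟨y, hya, hys⟩)]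
  · exact Filter.mem_of_superset (hs l) (hE i ▸ Set.subset_biUnion_of_mem (u := fun a => (p a).1) h)

end BoxDet

section BoxSpan

variable {Y : Type u} [TopologicalSpace Y] {H : Type*} [AddCommGroup H] {N n : ℕ}

/-- The tuples of ultrafilters with a common limit in `A`, the points at which box indicators are
evaluated. -/
def commonLim (A : Set Y) (N : ℕ) : Set (Fin N → Ultrafilter Y) :=
  {u | ∃ y ∈ A, ∀ l, (u l : Filter Y) ≤ 𝓝 y}

/-- The alternating indicator function of a box, as a function on `commonLim A N`. -/
noncomputable def boxInd (A : Set Y) (E : Fin N → Bdd Y) : commonLim A N → ℤ :=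
  fun u => boxDet u.1 E

/-- The group spanned by the box indicators. Chains supported on `A` are the homomorphisms on it,
by `IsChain.exists_boxSpan_linearMap` and `isChain_boxGen`. -/
noncomputable def boxSpan (A : Set Y) (N : ℕ) : Submodule ℤ (commonLim A N → ℤ) :=
  Submodule.span ℤ (Set.range (boxInd A))

/-- The box indicator as an element of `boxSpan A N`: the universal chain supported on `A`. -/
noncomputable def boxGen (A : Set Y) (E : Fin N → Bdd Y) : boxSpan A N :=
  ⟨boxInd A E, Submodule.subset_span ⟨E, rfl⟩⟩

theorem isChain_boxInd (A : Set Y) : IsChain (boxInd (N := n + 1) A) :=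
  IsChain.pi fun u => isChain_boxDet u.2.choose_spec.2

theorem isChain_boxGen (A : Set Y) : IsChain (boxGen (N := n + 1) A) :=
  .of_map_injective (φ := (boxSpan A (n + 1)).subtype.toAddMonoidHom) Subtype.val_injective
    (isChain_boxInd A)

theorem boxSpan_le_finiteRange (A : Set Y) (N : ℕ) : boxSpan A N ≤ finiteRange (commonLim A N) := by
  classical
  refine Submodule.span_le.2 (Set.range_subset_iff.2 fun E => ?_)
  refine (Set.finite_range fun P : Fin N → Fin N → Prop =>
    (Matrix.of fun l i => if P l i then (1 : ℤ) else 0).det).subset ?_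
  rintro _ ⟨u, rfl⟩
  exact ⟨fun l i => (E i).1 ∈ u.1 l, by simp only [boxInd, boxDet]⟩

/-- Cut all boxes of a relation into members of one disjoint family `p`. The coefficient of a box
`p ∘ s` in the relation for `f` is then the relation for box indicators at a tuple of ultrafilters
containing the `p (s l)`; such a tuple exists in `commonLim A` unless `f (p ∘ s) = 0`. -/
theorem IsChain.ker_linearCombination_boxInd_le {f : (Fin (n + 1) → Bdd Y) → H} (hf : IsChain f)
    {A : Set Y} (hfA : IsSupportedOn f A) :
    (Finsupp.linearCombination ℤ (boxInd (N := n + 1) A)).ker ≤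
      (Finsupp.linearCombination ℤ f).ker := by
  classical
  intro c hc
  obtain ⟨ι, _, _, p, S, hp, hS⟩ :=
    exists_common_partition (c.support.biUnion fun E => Finset.univ.image E)
  have hE : ∀ E ∈ c.support, ∀ i, (E i).1 = ⋃ a ∈ S (E i), (p a).1 := fun E hE i =>
    hS _ (Finset.mem_biUnion.2 ⟨E, hE, Finset.mem_image_of_mem E (Finset.mem_univ i)⟩)
  let δ (s : Fin (n + 1) → ι) (E : Fin (n + 1) → Bdd Y) : ℤ :=
    (Matrix.of fun l i => if s l ∈ S (E i) then (1 : ℤ) else 0).det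
  have hcoeff : ∀ s : Fin (n + 1) → ι, f (p ∘ s) ≠ 0 → ∑ E ∈ c.support, c E * δ s E = 0 := by
    intro s hs
    obtain ⟨y, hyA, hy⟩ := Set.nonempty_iff_ne_empty.2 (mt (hfA (p ∘ s)) hs)
    choose u hu hlim using fun l => mem_closure_iff_ultrafilter.1 (Set.mem_iInter.1 hy l)
    have hcu : ∑ E ∈ c.support, c E * boxDet u E = 0 := by
      simpa [Finsupp.linearCombination_apply, Finsupp.sum, boxInd] using
        congrFun (LinearMap.mem_ker.1 hc) ⟨u, y, hyA, hlim⟩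
    rw [← hcu]
    exact Finset.sum_congr rfl fun E hEc => by rw [boxDet_eq_det_of_partition hp (hE E hEc) hu]
  calc Finsupp.linearCombination ℤ f c = ∑ E ∈ c.support, c E • f E := rfl
    _ = ∑ E ∈ c.support, ∑ s : {s : Fin (n + 1) → ι // StrictMono s},
          (c E * δ s E) • f (p ∘ s) := Finset.sum_congr rfl fun E hEc => by
        simp only [hf.eq_sum_det_smul hp (hE E hEc), Finset.smul_sum, smul_smul, δ]
    _ = ∑ s : {s : Fin (n + 1) → ι // StrictMono s},
          (∑ E ∈ c.support, c E * δ s E) • f (p ∘ s) := by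
        rw [Finset.sum_comm]
        simp only [Finset.sum_smul]
    _ = 0 := Finset.sum_eq_zero fun s _ => by
        by_cases hs : f (p ∘ s) = 0
        · rw [hs, smul_zero]
        · rw [hcoeff s hs, zero_smul]

theorem IsChain.exists_boxSpan_linearMap {f : (Fin (n + 1) → Bdd Y) → H} (hf : IsChain f)
    {A : Set Y} (hfA : IsSupportedOn f A) :
    ∃ φ : boxSpan A (n + 1) →ₗ[ℤ] H, ∀ E, φ (boxGen A E) = f E :=
  exists_span_range_linearMap (hf.ker_linearCombination_boxInd_le hfA)

end BoxSpan

section Extension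

variable {X Y : Type u} [TopologicalSpace X] [TopologicalSpace Y] {j : X → Y} {N n : ℕ}

/-- Restriction of functions from `commonLim B N` to `commonLim A N`. -/
noncomputable def boxSpan.restrict {A B : Set Y} (h : A ⊆ B) (N : ℕ) :
    boxSpan B N →ₗ[ℤ] boxSpan A N :=
  (LinearMap.funLeft ℤ ℤ fun u : commonLim A N =>
    (⟨u.1, u.2.imp fun _ hy => ⟨h hy.1, hy.2⟩⟩ : commonLim B N)).restrict <|
      show boxSpan B N ≤ (boxSpan A N).comap _ from
        Submodule.span_le.2 (Set.range_subset_iff.2 fun E => (boxGen A E).2)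

theorem boxSpan.ext_boxGen {A : Set Y} {M : Type*} [AddCommGroup M] {φ ψ : boxSpan A N →ₗ[ℤ] M}
    (h : ∀ E, φ (boxGen A E) = ψ (boxGen A E)) : φ = ψ :=
  LinearMap.ext_on_range (v := boxGen A) ((Submodule.span_range_subtype_eq_top_iff _ _).2 rfl) h

/-- Push-forward of ultrafilters. -/
def commonLim.map (hj : Continuous j) (N : ℕ) (u : commonLim (Set.univ : Set X) N) :
    commonLim (Set.univ : Set Y) N :=
  ⟨fun l => (u.1 l).map j, u.2.imp' j fun _ hy =>
    ⟨trivial, fun l => (Filter.map_mono (hy.2 l)).trans hj.continuousAt⟩⟩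

variable [T2Space Y]

theorem boxInd_image_map (hj : Continuous j) (hinj : Function.Injective j) (E : Fin N → Bdd X)
    (u : commonLim Set.univ N) :
    boxInd Set.univ (fun i => Bdd.image j hj (E i)) (commonLim.map hj N u) =
      boxInd Set.univ E u := by
  classical
  refine congrArg Matrix.det (Matrix.ext fun l i => if_congr ?_ rfl rfl)
  rw [← Set.preimage_image_eq (E i).1 hinj]
  rfl

theorem boxGen_image_mem_ker (hj : Continuous j) (E : Fin (n + 1) → Bdd X) :
    boxGen Set.univ (fun i => Bdd.image j hj (E i)) ∈
      (boxSpan.restrict (Set.subset_univ (Set.range j)ᶜ) (n + 1)).ker := by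
  refine LinearMap.mem_ker.2 (Subtype.ext (funext fun ⟨u, y, hyj, hy⟩ => ?_))
  refine isSupportedOn_boxDet hy _ (Set.singleton_inter_eq_empty.2 fun hE => hyj ?_)
  have hy0 := Set.mem_iInter.1 hE 0
  rw [Bdd.closure_image] at hy0
  exact Set.image_subset_range _ _ hy0

theorem isSupportedOn_compl_range [LocallyCompactSpace X] {H : Type*} [AddCommGroup H]
    (hj : IsOpenEmbedding j) {f : (Fin (n + 1) → Bdd Y) → H} (hf : IsChain f)
    (h : ∀ E : Fin (n + 1) → Bdd X, f (fun i => Bdd.image j hj.continuous (E i)) = 0) :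
    IsSupportedOn f (Set.range j)ᶜ := by
  intro E hE
  have : T2Space X := hj.isEmbedding.t2Space
  have hEj : ⋂ i, closure (E i).1 ⊆ Set.range j := fun _ hy =>
    by_contra fun hyj => hE.subset ⟨hyj, hy⟩
  have hcpt : IsCompact (⋂ i, closure (E i).1) :=
    (E 0).2.of_isClosed_subset (isClosed_iInter fun _ => isClosed_closure) (Set.iInter_subset _ 0)
  obtain ⟨W, hW, hEW, hWc⟩ := exists_isOpen_superset_and_isCompact_closure
    (hj.isInducing.isCompact_preimage' hcpt hEj)
  have hEjW : Set.univ ∩ ⋂ i, closure (E i).1 ⊆ j '' W := by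
    rw [Set.univ_inter, ← Set.image_preimage_eq_of_subset hEj]
    exact Set.image_mono hEW
  rw [hf.isSupportedOn_univ.eq_inter hf (hj.isOpenMap W hW) E hEjW]
  convert h fun i => ⟨j ⁻¹' (E i).1 ∩ W,
    Bdd.isCompact_closure_of_subset (A := ⟨W, hWc⟩) Set.inter_subset_right⟩ using 2
  exact funext fun i => Subtype.ext (Set.image_preimage_inter j W (E i).1).symm

theorem ker_boxSpan_restrict_le [LocallyCompactSpace X] (hj : IsOpenEmbedding j) :
    (boxSpan.restrict (Set.subset_univ (Set.range j)ᶜ) (n + 1)).ker ≤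
      Submodule.span ℤ (Set.range fun E : Fin (n + 1) → Bdd X =>
        boxGen Set.univ fun i => Bdd.image j hj.continuous (E i)) := by
  set P := Submodule.span ℤ (Set.range fun E : Fin (n + 1) → Bdd X =>
    boxGen Set.univ fun i => Bdd.image j hj.continuous (E i))
  have hq : IsChain fun E : Fin (n + 1) → Bdd Y => P.mkQ (boxGen Set.univ E) :=
    (isChain_boxGen Set.univ).map P.mkQ.toAddMonoidHom
  obtain ⟨φ, hφ⟩ := hq.exists_boxSpan_linearMap <| isSupportedOn_compl_range hj hq fun E =>
    (Submodule.Quotient.mk_eq_zero P).2 (Submodule.subset_span ⟨E, rfl⟩)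
  have hφr : φ ∘ₗ boxSpan.restrict (Set.subset_univ (Set.range j)ᶜ) (n + 1) = P.mkQ :=
    boxSpan.ext_boxGen hφ
  intro x hx
  rw [← P.ker_mkQ, ← hφr]
  exact LinearMap.ker_le_ker_comp _ _ hx

theorem exists_boxSpan_pullback [LocallyCompactSpace X] (hj : IsOpenEmbedding j) :
    ∃ φ : (boxSpan.restrict (Set.subset_univ (Set.range j)ᶜ) (n + 1)).ker →ₗ[ℤ]
        boxSpan (Set.univ : Set X) (n + 1),
      ∀ E, φ ⟨_, boxGen_image_mem_ker hj.continuous E⟩ = boxGen Set.univ E := by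
  let pull := LinearMap.funLeft ℤ ℤ (commonLim.map hj.continuous (n + 1)) ∘ₗ
    (boxSpan Set.univ (n + 1)).subtype
  have hpull : ∀ E, pull (boxGen Set.univ fun i => Bdd.image j hj.continuous (E i)) =
      boxInd Set.univ E := fun E => funext (boxInd_image_map hj.continuous hj.injective E)
  have hle : (boxSpan.restrict (Set.subset_univ (Set.range j)ᶜ) (n + 1)).ker ≤
      (boxSpan Set.univ (n + 1)).comap pull := by
    refine (ker_boxSpan_restrict_le hj).trans
      (Submodule.span_le.2 (Set.range_subset_iff.2 fun E => ?_))
    rw [SetLike.mem_coe, Submodule.mem_comap, hpull]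
    exact (boxGen Set.univ E).2
  exact ⟨pull.restrict hle, fun E => Subtype.ext (hpull E)⟩

theorem IsChain.exists_extension [LocallyCompactSpace X] {G : Type v} [AddCommGroup G]
    (hj : IsOpenEmbedding j) {f : (Fin (n + 1) → Bdd X) → G} (hf : IsChain f) :
    ∃ F : (Fin (n + 1) → Bdd Y) → G, IsChain F ∧
      ∀ E, F (fun i => Bdd.image j hj.continuous (E i)) = f E := by
  obtain ⟨φ, hφ⟩ := hf.exists_boxSpan_linearMap hf.isSupportedOn_univ
  obtain ⟨pull, hpull⟩ := exists_boxSpan_pullback (n := n) hj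
  let r := boxSpan.restrict (Set.subset_univ (Set.range j)ᶜ) (n + 1)
  let incl := Submodule.inclusion (boxSpan_le_finiteRange (Set.range j)ᶜ (n + 1))
  have hker : (incl ∘ₗ r).ker = r.ker :=
    LinearMap.ker_comp_of_ker_eq_bot r (Submodule.ker_inclusion _ _ _)
  obtain ⟨g, hg⟩ := exists_comp_subtype_ker_eq (incl ∘ₗ r)
    (φ ∘ₗ pull ∘ₗ (LinearEquiv.ofEq _ _ hker).toLinearMap)
  refine ⟨fun E => g (boxGen Set.univ E), (isChain_boxGen Set.univ).map g.toAddMonoidHom,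
    fun E => ?_⟩
  have hE := LinearMap.congr_fun hg ⟨_, hker ▸ boxGen_image_mem_ker hj.continuous E⟩
  exact hE.trans ((congrArg φ (hpull E)).trans (hφ E))

theorem restrict_surjective [LocallyCompactSpace X] (G : Type v) [AddCommGroup G]
    (hj : IsOpenEmbedding j) (n : ℕ) : Function.Surjective (restrict G j hj n) := fun f =>
  let ⟨F, hF, hFf⟩ := f.2.exists_extension hj
  ⟨⟨F, hF⟩, Subtype.ext (funext hFf)⟩

end Extension

section Cone

variable {Y : Type u} [TopologicalSpace Y] {H H' : Type*} [AddCommGroup H] [AddCommGroup H']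
  {n : ℕ} {y : Y}

open Classical in
/-- The cone with vertex `y` over `f`: the shuffle product of the point mass at `y` with `f`. -/
noncomputable def cone (y : Y) (f : (Fin (n + 1) → Bdd Y) → H) (E : Fin (n + 1 + 1) → Bdd Y) : H :=
  ∑ k, if y ∈ (E k).1 then (-1 : ℤ) ^ (k : ℕ) • f (E ∘ k.succAbove) else 0

theorem cone_eq_zero {f : (Fin (n + 1) → Bdd Y) → H} {E : Fin (n + 1 + 1) → Bdd Y}
    (h : ∀ k, y ∉ (E k).1) : cone y f E = 0 :=
  Finset.sum_eq_zero fun k _ => if_neg (h k)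

open Classical in
theorem cone_cons_of_mem (f : (Fin (n + 1) → Bdd Y) → H) {U : Bdd Y} (hU : y ∈ U.1)
    (E : Fin (n + 1) → Bdd Y) : cone y f (Fin.cons U E) = f E -
      ∑ k, if y ∈ (E k).1 then (-1 : ℤ) ^ (k : ℕ) • f (Fin.cons U E ∘ k.succ.succAbove) else 0 := by
  rw [cone, Fin.sum_univ_succ, sub_eq_add_neg, ← Finset.sum_neg_distrib]
  congr 1
  · exact (if_pos hU).trans (one_smul ℤ (f E))
  · refine Finset.sum_congr rfl fun k _ => ?_
    change (if y ∈ (E k).1 then _ else 0) = _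
    rw [Fin.val_succ, pow_succ, mul_neg_one, neg_smul]
    split_ifs <;> simp

theorem map_cone (φ : H →+ H') (f : (Fin (n + 1) → Bdd Y) → H) (E : Fin (n + 1 + 1) → Bdd Y) :
    φ (cone y f E) = cone y (fun E => φ (f E)) E := by
  simp only [cone, map_sum, apply_ite φ, map_zsmul, map_zero]

theorem cone_boxDet (u : Fin (n + 1) → Ultrafilter Y) :
    cone y (boxDet u) = boxDet (Fin.cons (pure y) u) := by
  classical
  funext E
  rw [boxDet, Matrix.det_succ_row_zero]
  refine Finset.sum_congr rfl fun k _ => ?_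
  by_cases hk : y ∈ (E k).1
  · simp [hk, boxDet, Matrix.submatrix, Matrix.of_apply]
  · simp [hk]

theorem isChain_cone_boxGen (y : Y) : IsChain (cone y (boxGen (N := n + 1) {y})) := by
  refine .of_map_injective (φ := (boxSpan {y} (n + 1)).subtype.toAddMonoidHom)
    Subtype.val_injective (IsChain.pi fun u => ?_)
  have hcons : ∀ l,
      ((Fin.cons (pure y) u.1 : Fin (n + 1 + 1) → Ultrafilter Y) l : Filter Y) ≤ 𝓝 y :=
    Fin.cases (pure_le_nhds y) fun l => by
      obtain ⟨_, rfl, hu⟩ := u.2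
      exact hu l
  convert isChain_boxDet hcons using 2 with E
  rw [← cone_boxDet]
  let ev : boxSpan {y} (n + 1) →+ ℤ :=
    (Pi.evalAddMonoidHom _ u).comp (boxSpan {y} (n + 1)).subtype.toAddMonoidHom
  exact map_cone ev (boxGen {y}) E

theorem IsChain.cone {f : (Fin (n + 1) → Bdd Y) → H} (hf : IsChain f)
    (hfy : IsSupportedOn f {y}) : IsChain (cone y f) := by
  obtain ⟨φ, hφ⟩ := hf.exists_boxSpan_linearMap hfy
  rw [← funext hφ]
  simpa only [← LinearMap.toAddMonoidHom_coe, map_cone] using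
    (isChain_cone_boxGen y).map φ.toAddMonoidHom

/-- The cone with vertex `y` over a chain supported at `y`. -/
noncomputable def coneChain (F : chains Y H n) (hF : IsSupportedOn F.1 {y}) : chains Y H (n + 1) :=
  ⟨cone y F.1, F.2.cone hF⟩

theorem IsSupportedOn.const_eq_const {f : (Fin (n + 1) → Bdd Y) → H} (hf : IsChain f)
    (hfy : IsSupportedOn f {y}) {U V : Bdd Y} (hU : IsOpen U.1) (hyU : y ∈ U.1) (hV : IsOpen V.1)
    (hyV : y ∈ V.1) : (f fun _ => U) = f fun _ => V := by
  rw [hfy.eq_inter hf hV (fun _ => U) fun z hz => hz.1 ▸ hyV,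
    hfy.eq_inter hf hU (fun _ => V) fun z hz => hz.1 ▸ hyU]
  exact congrArg f (funext fun _ => Subtype.ext (Set.inter_comm _ _))

variable [LocallyCompactSpace Y] [T2Space Y]

theorem exists_mem_surrounds (y : Y) (E : Fin (n + 1) → Bdd Y) :
    ∃ U : Bdd Y, y ∈ U.1 ∧ Surrounds U E := by
  obtain ⟨U, hU, hEU⟩ := exists_surrounds
    (Fin.cons ⟨{y}, isCompact_singleton.closure⟩ E : Fin (n + 1 + 1) → Bdd Y)
  have hsub := Set.iUnion_subset_iff.1 hEU
  exact ⟨U, hsub 0 (subset_closure rfl), hU, Set.iUnion_subset fun i => hsub i.succ⟩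

theorem bdryFun_cone {f : (Fin (n + 1 + 1) → Bdd Y) → H} (hf : IsChain f)
    (hfy : IsSupportedOn f {y}) (E : Fin (n + 1 + 1) → Bdd Y) :
    bdryFun (cone y f) E = f E - cone y (bdryFun f) E := by
  obtain ⟨U, hyU, hU⟩ := exists_mem_surrounds y E
  have hcons : ∀ k : Fin (n + 1 + 1), f (Fin.cons U E ∘ k.succ.succAbove) =
      bdryFun f (E ∘ k.succAbove) := fun k => by
    have hUk : Surrounds U (E ∘ k.succAbove) :=
      ⟨hU.1, Set.iUnion_subset fun i => hU.closure_subset (k.succAbove i)⟩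
    rw [bdryFun_eq hf _ U hUk]
    exact congrArg f (funext (Fin.cases (by simp) fun i => by simp))
  rw [bdryFun_eq (hf.cone hfy) E U hU, cone_cons_of_mem f hyU]
  simp only [hcons, cone]

open Classical in
theorem bdryFun_cone_zero {f : (Fin (0 + 1) → Bdd Y) → H} (hf : IsChain f)
    (hfy : IsSupportedOn f {y}) {V : Bdd Y} (hV : IsOpen V.1) (hyV : y ∈ V.1)
    (E : Fin (0 + 1) → Bdd Y) :
    bdryFun (cone y f) E = f E - if y ∈ (E 0).1 then f (fun _ => V) else 0 := by
  obtain ⟨U, hyU, hU⟩ := exists_mem_surrounds y E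
  have hcons : (Fin.cons U (Fin.tail E) : Fin (0 + 1) → Bdd Y) = fun _ => U :=
    funext (Fin.cases rfl fun k => k.elim0)
  simp [bdryFun_eq (hf.cone hfy) E U hU, cone_cons_of_mem f hyU, hcons,
    hfy.const_eq_const hf hU.1 hyU hV hyV]

end Cone

section Singleton

variable {Y : Type u} [TopologicalSpace Y] [T2Space Y] {G : Type v} [AddCommGroup G]
  {n : ℕ} {y : Y}

theorem push_singleton_eq_of_mem_iff (g : chains ({y} : Set Y) G n) {E E' : Fin (n + 1) → Bdd Y}
    (h : ∀ i, y ∈ (E i).1 ↔ y ∈ (E' i).1) :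
    (push G _ (isProperMap_val isClosed_singleton) n g).1 E =
      (push G _ (isProperMap_val isClosed_singleton) n g).1 E' :=
  congrArg g.1 (funext fun i => Subtype.ext (Set.ext fun ⟨_, hz⟩ => by
    obtain rfl := hz
    exact h i))

theorem push_singleton_eq_zero (g : chains ({y} : Set Y) G n) {E : Fin (n + 1) → Bdd Y}
    {i : Fin (n + 1)} (h : y ∉ (E i).1) :
    (push G _ (isProperMap_val isClosed_singleton) n g).1 E = 0 :=
  IsAdditive.eq_zero_of_eq_empty (i := i) g.2.add <|
    Set.eq_empty_iff_forall_notMem.2 fun ⟨_, hz⟩ hzE => h (Set.mem_singleton_iff.1 hz ▸ hzE)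

open Classical in
theorem exists_push_singleton_eq_ite (y : Y) (c : G) :
    ∃ g : chains ({y} : Set Y) G 0, ∀ E,
      (push G _ (isProperMap_val isClosed_singleton) 0 g).1 E = if y ∈ (E 0).1 then c else 0 := by
  let a : ({y} : Set Y) := ⟨y, rfl⟩
  have hpure : IsChain (boxDet fun _ : Fin (0 + 1) => (pure a : Ultrafilter ({y} : Set Y))) :=
    isChain_boxDet fun _ => pure_le_nhds a
  refine ⟨⟨_, hpure.map (zmultiplesHom G c)⟩, fun E => ?_⟩
  change boxDet _ _ • c = _
  simp [boxDet, Bdd.preimage, a]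

variable [LocallyCompactSpace Y]

theorem bdry_eq_zero_of_eq_push_singleton {F : chains Y G (n + 1)} (hF : IsSupportedOn F.1 {y})
    {g : chains ({y} : Set Y) G n}
    (h : push G _ (isProperMap_val isClosed_singleton) n g = bdry Y G n F) :
    bdry Y G n F = 0 := by
  obtain ⟨V, hyV, hV, -⟩ := exists_mem_surrounds (n := 0) y fun _ => ⟨∅, by simp⟩
  have hVV : (bdry Y G n F).1 (fun _ => V) = 0 := by
    set U := surround fun _ : Fin (n + 1) => V
    have hVU : V.1 ⊆ U.1 := subset_closure.trans ((surround_spec fun _ => V).closure_subset 0)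
    have hcut : (fun i => ((Fin.cons U fun _ => V : Fin (n + 1 + 1) → Bdd Y) i).inter V.1) =
        fun _ => V :=
      funext (Fin.cases (Subtype.ext (Set.inter_eq_right.2 hVU))
        fun _ => Subtype.ext (Set.inter_self _))
    refine (hF.eq_inter F.2 hV _ fun z hz => hz.1 ▸ hyV).trans ?_
    exact hcut ▸ F.2.alt _ 0 (Fin.succ 0) (Fin.succ_ne_zero 0).symm rfl
  rw [← h] at hVV ⊢
  refine Subtype.ext (funext fun E => ?_)
  by_cases! hE : ∀ i, y ∈ (E i).1
  · exact (push_singleton_eq_of_mem_iff g fun i => iff_of_true (hE i) hyV).trans hVV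
  · obtain ⟨i, hi⟩ := hE
    exact push_singleton_eq_zero g hi

theorem bdry_coneChain {F : chains Y G (n + 1)} (hF : IsSupportedOn F.1 {y})
    (h : bdry Y G n F = 0) : bdry Y G (n + 1) (coneChain F hF) = F := by
  have hzero : bdryFun F.1 = 0 := congrArg Subtype.val h
  refine Subtype.ext (funext fun E => (bdryFun_cone F.2 hF E).trans ?_)
  simp [hzero, cone]

theorem exists_bdry_coneChain_add_push (F : chains Y G 0) (hF : IsSupportedOn F.1 {y}) :
    ∃ g : chains ({y} : Set Y) G 0, bdry Y G 0 (coneChain F hF) +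
      push G _ (isProperMap_val isClosed_singleton) 0 g = F := by
  obtain ⟨V, hyV, hV, -⟩ := exists_mem_surrounds (n := 0) y fun _ => ⟨∅, by simp⟩
  obtain ⟨g, hg⟩ := exists_push_singleton_eq_ite y (F.1 fun _ => V)
  refine ⟨g, Subtype.ext (funext fun E => ?_)⟩
  change bdryFun (cone y F.1) E + (push G _ (isProperMap_val isClosed_singleton) 0 g).1 E = F.1 E
  rw [hg, bdryFun_cone_zero F.2 hF hV hyV, sub_add_cancel]

end Singleton

section HomologicalAlgebra

universe w

variable {ι : Type*} {c : ComplexShape ι}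

theorem isIso_homologyMap_of_shortExact {C : Type*} [Category* C] [Abelian C]
    {S : ShortComplex (HomologicalComplex C c)} (hS : S.ShortExact) (h : S.X₁.Acyclic) (i : ι) :
    IsIso (HomologicalComplex.homologyMap S.g i) := by
  have hz : ∀ j, IsZero (S.X₁.homology j) := fun j => (h j).isZero_homology
  have : Mono (HomologicalComplex.homologyMap S.g i) :=
    (hS.homology_exact₂ i).mono_g ((hz i).eq_of_src _ _)
  have : Epi (HomologicalComplex.homologyMap S.g i) := by
    by_cases! hi : ∃ j, c.Rel i j
    · obtain ⟨j, hij⟩ := hi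
      exact (hS.homology_exact₃ i j hij).epi_f ((hz j).eq_of_tgt _ _)
    · have := hS.epi_g
      exact HomologicalComplex.epi_homologyMap_of_epi_of_not_rel S.g i hi
  exact isIso_of_mono_of_epi _

variable {K L M : HomologicalComplex AddCommGrpCat.{w} c}

theorem acyclic_kernel_of_forall_exists (φ : L ⟶ M)
    (hk : ∀ j (x : L.X j), φ.f j x = 0 → L.d j (c.next j) x = 0 →
      ∃ w : L.X (c.prev j), φ.f _ w = 0 ∧ L.d _ j w = x) :
    (kernel φ).Acyclic := by
  have hex : ∀ i, (ShortComplex.mk ((kernel.ι φ).f i) (φ.f i)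
      (by rw [← HomologicalComplex.comp_f, kernel.condition, HomologicalComplex.zero_f])).Exact :=
    (HomologicalComplex.exact_iff_degreewise_exact
      (ShortComplex.mk (kernel.ι φ) φ (kernel.condition φ))).1
        (ShortComplex.exact_of_f_is_kernel _ (kernelIsKernel φ))
  have hinj : ∀ i, Function.Injective ((kernel.ι φ).f i) := fun i =>
    (AddCommGrpCat.mono_iff_injective _).1 inferInstance
  have hcomm : ∀ i k (x : (kernel φ).X i), (kernel.ι φ).f k ((kernel φ).d i k x) =
      L.d i k ((kernel.ι φ).f i x) := fun i k x =>
    (ConcreteCategory.congr_hom ((kernel.ι φ).comm i k) x).symm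
  intro j
  rw [HomologicalComplex.exactAt_iff, ShortComplex.ab_exact_iff]
  intro z hz
  obtain ⟨w, hw, hdw⟩ := hk j ((kernel.ι φ).f j z)
    (ConcreteCategory.congr_hom (HomologicalComplex.congr_hom (kernel.condition φ) j) z)
    ((hcomm _ _ z).symm.trans ((congrArg _ hz).trans (map_zero _)))
  obtain ⟨x, rfl⟩ := (ShortComplex.ab_exact_iff _).1 (hex _) w hw
  exact ⟨x, hinj j ((hcomm _ _ x).trans hdw)⟩

theorem isIso_homologyMap_of_surjective (φ : L ⟶ M) (hs : ∀ i, Function.Surjective (φ.f i))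
    (hk : ∀ j (x : L.X j), φ.f j x = 0 → L.d j (c.next j) x = 0 →
      ∃ w : L.X (c.prev j), φ.f _ w = 0 ∧ L.d _ j w = x) (n : ι) :
    IsIso (HomologicalComplex.homologyMap φ n) := by
  have : ∀ i, Epi (φ.f i) := fun i => (AddCommGrpCat.epi_iff_surjective _).2 (hs i)
  have : Epi φ := HomologicalComplex.epi_of_epi_f φ inferInstance
  have hS : (ShortComplex.mk (kernel.ι φ) φ (kernel.condition φ)).ShortExact :=
    { exact := ShortComplex.exact_of_f_is_kernel _ (kernelIsKernel φ)
      mono_f := inferInstanceAs (Mono (kernel.ι φ))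
      epi_g := this }
  exact isIso_homologyMap_of_shortExact hS (acyclic_kernel_of_forall_exists φ hk) n

theorem cokernel_π_f_surjective (p : K ⟶ L) (i : ι) :
    Function.Surjective ((cokernel.π p).f i) :=
  (AddCommGrpCat.epi_iff_surjective _).1 inferInstance

theorem exists_of_cokernel_π_f_eq_zero (p : K ⟶ L) (i : ι) (x : L.X i)
    (hx : (cokernel.π p).f i x = 0) : ∃ g : K.X i, p.f i g = x :=
  (ShortComplex.ab_exact_iff _).1 ((HomologicalComplex.exact_iff_degreewise_exact
    (ShortComplex.mk p (cokernel.π p) (cokernel.condition p))).1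
      (ShortComplex.exact_of_g_is_cokernel _ (cokernelIsCokernel p)) i) x hx

theorem isIso_homologyMap_cokernel_desc (p : K ⟶ L) (r : L ⟶ M) (hpr : p ≫ r = 0)
    (hs : ∀ i, Function.Surjective (r.f i))
    (hk : ∀ i j k, c.prev j = i → c.next j = k → ∀ x : L.X j, r.f j x = 0 →
      (∃ g, p.f k g = L.d j k x) →
      ∃ (w : L.X i) (g : K.X j), r.f i w = 0 ∧ L.d i j w + p.f j g = x) (n : ι) :
    IsIso (HomologicalComplex.homologyMap (cokernel.desc p r hpr) n) := by
  have hπr : ∀ i (x : L.X i), (cokernel.desc p r hpr).f i ((cokernel.π p).f i x) = r.f i x :=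
    fun i x =>
      ConcreteCategory.congr_hom (HomologicalComplex.congr_hom (cokernel.π_desc p r hpr) i) x
  have hπd : ∀ i k (x : L.X i), (cokernel p).d i k ((cokernel.π p).f i x) =
      (cokernel.π p).f k (L.d i k x) := fun i k x =>
    ConcreteCategory.congr_hom ((cokernel.π p).comm i k) x
  have hpπ : ∀ i (g : K.X i), (cokernel.π p).f i (p.f i g) = 0 := fun i g =>
    ConcreteCategory.congr_hom (HomologicalComplex.congr_hom (cokernel.condition p) i) g
  refine isIso_homologyMap_of_surjective _ (fun i m => ?_) (fun j q hq hdq => ?_) n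
  · obtain ⟨x, rfl⟩ := hs i m
    exact ⟨(cokernel.π p).f i x, hπr i x⟩
  · obtain ⟨x, rfl⟩ := cokernel_π_f_surjective p j q
    obtain ⟨w, g, hw, rfl⟩ := hk _ j _ rfl rfl x ((hπr j x).symm.trans hq)
      (exists_of_cokernel_π_f_eq_zero p _ _ ((hπd _ _ x).symm.trans hdq))
    refine ⟨(cokernel.π p).f _ w, (hπr _ w).trans hw, (hπd _ _ w).trans ?_⟩
    rw [map_add, hpπ, add_zero]

end HomologicalAlgebra

section Main

variable {X Y : Type u} [TopologicalSpace X] [TopologicalSpace Y] [T2Space Y]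
  {G : Type v} [AddCommGroup G] {j : X → Y} {y : Y}

theorem isSupportedOn_singleton_of_restrict_eq_zero [LocallyCompactSpace X]
    (hj : IsOpenEmbedding j) (hy : Set.range j = {y}ᶜ) {n : ℕ} {F : chains Y G n}
    (hF : restrict G j hj n F = 0) : IsSupportedOn F.1 {y} := by
  have hyc : (Set.range j)ᶜ = {y} := by rw [hy, compl_compl]
  exact hyc ▸ isSupportedOn_compl_range hj F.2 (congrFun (congrArg Subtype.val hF))

theorem restrict_coneChain (hj : IsOpenEmbedding j) (hy : Set.range j = {y}ᶜ) {n : ℕ}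
    {F : chains Y G n} (hF : IsSupportedOn F.1 {y}) :
    restrict G j hj (n + 1) (coneChain F hF) = 0 :=
  Subtype.ext <| funext fun _ => cone_eq_zero fun _ hyE =>
    hy.subset (Set.image_subset_range _ _ hyE) rfl

variable [LocallyCompactSpace Y]

theorem complex_d_apply {n : ℕ} (F : chains Y G (n + 1)) :
    (complex Y G).d (n + 1) n F = bdry Y G n F := by
  simp only [complex, ChainComplex.of_d]
  rfl

theorem isIso_relRestrict_singleton [LocallyCompactSpace X] [T2Space X] (hj : IsOpenEmbedding j)
    (hy : Set.range j = {y}ᶜ) (n : ℕ) :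
    IsIso (relRestrict G {y} isClosed_singleton j hj (Set.range_subset_iff.1 hy.subset) n) := by
  have : LocallyCompactSpace ({y} : Set Y) :=
    isClosed_singleton.isClosedEmbedding_subtypeVal.locallyCompactSpace
  refine isIso_homologyMap_cokernel_desc _ _ _ (restrict_surjective G hj)
    (fun i m k hi hk F hF hdF => ?_) n
  have hFy := isSupportedOn_singleton_of_restrict_eq_zero hj hy hF
  obtain rfl : m + 1 = i := (ChainComplex.prev ℕ m).symm.trans hi
  cases m with
  | zero =>
    obtain ⟨g, hg⟩ := exists_bdry_coneChain_add_push F hFy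
    refine ⟨coneChain F hFy, g, restrict_coneChain hj hy hFy, ?_⟩
    exact (congrArg (· + _) (complex_d_apply (coneChain F hFy))).trans hg
  | succ m =>
    obtain rfl : m = k := (ChainComplex.next_nat_succ m).symm.trans hk
    obtain ⟨g, hg⟩ := hdF
    have hdF0 := bdry_eq_zero_of_eq_push_singleton hFy (hg.trans (complex_d_apply F))
    refine ⟨coneChain F hFy, 0, restrict_coneChain hj hy hFy, ?_⟩
    rw [map_zero, add_zero]
    exact (complex_d_apply (coneChain F hFy)).trans (bdry_coneChain hFy hdF0)

end Main

end Kolmogoroff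

theorem corollary2_general {X Y : Type u} [TopologicalSpace X] [LocallyCompactSpace X] [T2Space X]
    [TopologicalSpace Y] [LocallyCompactSpace Y] [T2Space Y] (G : Type v) [AddCommGroup G]
    {j : X → Y} (hj : IsOpenEmbedding j) {y : Y} (hy : Set.range j = {y}ᶜ) (n : ℕ) :
    ∃ ρ : Kolmogoroff.homology X G n ≅ Kolmogoroff.relHomology G {y} isClosed_singleton n,
      ρ.inv = Kolmogoroff.relRestrict G {y} isClosed_singleton j hj
        (Set.range_subset_iff.1 hy.subset) n :=
  have := Kolmogoroff.isIso_relRestrict_singleton (G := G) hj hy n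
  ⟨(asIso (Kolmogoroff.relRestrict G {y} isClosed_singleton j hj _ n)).symm, rfl⟩

theorem corollary2 {X : Type u} [TopologicalSpace X] [LocallyCompactSpace X] [ParacompactSpace X]
    [T2Space X] (G : Type v) [AddCommGroup G] (n : ℕ) :
    ∃ ρ : Kolmogoroff.homology X G n ≅
        Kolmogoroff.relHomology G ({OnePoint.infty} : Set (OnePoint X)) isClosed_singleton n,
      ρ.inv = Kolmogoroff.relRestrict G ({OnePoint.infty} : Set (OnePoint X)) isClosed_singleton
        ((↑) : X → OnePoint X) OnePoint.isOpenEmbedding_coe OnePoint.coe_ne_infty n :=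
  corollary2_general G OnePoint.isOpenEmbedding_coe OnePoint.compl_infty.symm n
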